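/- A group $G$ is called capable if there is a group $K$ such that $G \cong K/Z(K)$, where $Z(K)$ is the centre of $K$. Let $p$ be an odd prime, and let $G_1$ and $G_2$ be finite noncyclic $p$-groups of nilpotency class at most $2$ and exponent $p$. Then the direct sum (direct product) $G_1 \oplus G_2$ is capable if and only if both $G_1$ and $G_2$ are capable. -/

import Mathlib

universe u v

/-- A group `G` is *capable* if it is isomorphic to the central quotient `K / Z(K)` of some
group `K`.  Taking `K` in the universe of `G` is no restriction: if `K / Z(K) ≅ G`, lifts to `K` of
the elements of `G` generate a subgroup `H` of `K` with `H Z(K) = K`, so that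
`Z(H) = H ∩ Z(K)` and `H / Z(H) ≅ G`, and the cardinality of `H` is at most `max (#G) ℵ₀`. -/
def IsCapable (G : Type u) [Group G] : Prop :=
  ∃ (K : Type u) (_ : Group K), Nonempty (K ⧸ Subgroup.center K ≃* G)

/-!
The epicentre of `G` is the intersection of the images in `G` of the centres of all central
extensions of `G`, and `G` is capable iff it is trivial. Surjections map epicentres into epicentres.
Hence a product of capable groups is capable, and if `Gᵃᵇ` is capable, then the epicentre of `G` is
contained in the commutator subgroup.

Let `K` be a central extension of `G × H`, with `L` and `M` the preimages of `G` and `H`. Since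
`⁅L, M⁆` is central, the three subgroups lemma shows that `⁅L, L⁆` centralizes `M`; as `K = L M`, an
element of `⁅L, L⁆` that is central in `L` is central in `K`. So epicentral elements of `G` in the
commutator subgroup stay epicentral in `G × H`: if `Gᵃᵇ` and `G × H` are capable, so is `G`.

For `G` noncyclic of prime exponent `p` and nilpotent, `Gᵃᵇ` is a vector space `V` over `ZMod p` of
dimension `≠ 1`. It is capable because in the extension of `V` by `V ⊗ V` with cocycle
`(v, w) ↦ v ⊗ w` the lifts of `v` and `w` commute only if `v ⊗ w = w ⊗ v`.
-/

open Subgroup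
open scoped commutatorElement

universe w

/-- The quotient `F / [F, R]` of the free group `F` on the elements of `G`, where `R` is the kernel
of the canonical map `F → G`. It is a central extension of `G` that maps to every other one, and it
lives in the universe of `G`. -/
abbrev FreeCentralExtension (G : Type u) [Group G] : Type u :=
  FreeGroup G ⧸ ⁅(⊤ : Subgroup (FreeGroup G)), (FreeGroup.lift (id : G → G)).ker⁆

namespace FreeCentralExtension

variable (G : Type u) [Group G]

/-- The canonical map of the free central extension of `G` onto `G`. -/
def proj : FreeCentralExtension G →* G :=
  QuotientGroup.lift _ (FreeGroup.lift id) (commutator_le_right _ _)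

variable {G}

theorem proj_mk (a : FreeGroup G) : proj G (a : FreeCentralExtension G) = FreeGroup.lift id a :=
  rfl

theorem proj_surjective : Function.Surjective (proj G) := fun g =>
  ⟨(FreeGroup.of g : FreeGroup G), by rw [proj_mk, FreeGroup.lift_apply_of, id]⟩

theorem ker_proj_le_center : (proj G).ker ≤ center (FreeCentralExtension G) := by
  intro z hz
  obtain ⟨r, rfl⟩ := QuotientGroup.mk_surjective z
  refine mem_center_iff.2 fun y => ?_
  obtain ⟨a, rfl⟩ := QuotientGroup.mk_surjective y
  rw [← commutatorElement_eq_one_iff_mul_comm]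
  exact (QuotientGroup.eq_one_iff ⁅a, r⁆).2 (commutator_mem_commutator (mem_top a) hz)

theorem exists_comp_eq_comp_proj {Q : Type v} {K : Type w} [Group Q] [Group K] (f : G →* Q)
    {ρ : K →* Q} (hρ : Function.Surjective ρ) (hcentral : ρ.ker ≤ center K) :
    ∃ φ : FreeCentralExtension G →* K, ρ.comp φ = f.comp (proj G) := by
  choose s hs using hρ
  let ψ : FreeGroup G →* K := FreeGroup.lift (s ∘ f)
  have hψ : ρ.comp ψ = f.comp (FreeGroup.lift id) :=
    FreeGroup.ext_hom _ _ fun g => by simp [ψ, hs]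
  have hker : ⁅(⊤ : Subgroup (FreeGroup G)), (FreeGroup.lift (id : G → G)).ker⁆ ≤ ψ.ker := by
    refine commutator_le.2 fun a _ r hr => ?_
    have hψr : ρ (ψ r) = 1 := by
      rw [← MonoidHom.comp_apply, hψ, MonoidHom.comp_apply, MonoidHom.mem_ker.1 hr, map_one]
    rw [MonoidHom.mem_ker, map_commutatorElement, commutatorElement_eq_one_iff_mul_comm]
    exact mem_center_iff.1 (hcentral hψr) (ψ a)
  exact ⟨QuotientGroup.lift _ ψ hker, QuotientGroup.monoidHom_ext _ hψ⟩

end FreeCentralExtension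

section Epicenter

variable {G : Type u} {Q : Type v} {K : Type w} [Group G] [Group Q] [Group K]

theorem map_center_le_center_of_ker_le_center {φ : G →* K} {ρ : K →* Q}
    (hsurj : Function.Surjective (ρ.comp φ)) (hcentral : ρ.ker ≤ center K) :
    (center G).map φ ≤ center K := by
  rintro _ ⟨z, hz, rfl⟩
  refine mem_center_iff.2 fun k => ?_
  obtain ⟨a, ha⟩ := hsurj (ρ k)
  have hk : (φ a)⁻¹ * k ∈ center K := hcentral <| by
    rw [MonoidHom.mem_ker, map_mul, map_inv, ← ha, MonoidHom.comp_apply, inv_mul_cancel]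
  calc k * φ z = φ a * ((φ a)⁻¹ * k * φ z) := by group
    _ = φ (a * z) * ((φ a)⁻¹ * k) := by
      rw [← mem_center_iff.1 hk (φ z), map_mul, mul_assoc]
    _ = φ z * k := by rw [mem_center_iff.1 hz a, map_mul, mul_assoc, mul_inv_cancel_left]

variable (G) in
/-- The epicentre of `G`: the elements of `G` all of whose lifts to any central extension are
central. It is computed here in the single extension `FreeCentralExtension G`, which suffices by
`epicenter_le_map_center`. -/
def epicenter : Subgroup G :=
  (center (FreeCentralExtension G)).map (FreeCentralExtension.proj G)

theorem map_epicenter_le_map_center {f : G →* Q} (hf : Function.Surjective f) {ρ : K →* Q}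
    (hρ : Function.Surjective ρ) (hcentral : ρ.ker ≤ center K) :
    (epicenter G).map f ≤ (center K).map ρ := by
  obtain ⟨φ, hφ⟩ := FreeCentralExtension.exists_comp_eq_comp_proj f hρ hcentral
  rw [epicenter, map_map, ← hφ, ← map_map]
  refine map_mono (map_center_le_center_of_ker_le_center ?_ hcentral)
  exact hφ ▸ hf.comp FreeCentralExtension.proj_surjective

theorem epicenter_le_map_center {ρ : K →* G} (hρ : Function.Surjective ρ)
    (hcentral : ρ.ker ≤ center K) : epicenter G ≤ (center K).map ρ := by
  simpa only [map_id] using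
    map_epicenter_le_map_center (f := MonoidHom.id G) Function.surjective_id hρ hcentral

theorem map_epicenter_le {f : G →* Q} (hf : Function.Surjective f) :
    (epicenter G).map f ≤ epicenter Q :=
  map_epicenter_le_map_center hf FreeCentralExtension.proj_surjective
    FreeCentralExtension.ker_proj_le_center

theorem epicenter_eq_bot_of_ker_eq_center {ρ : K →* G} (hρ : Function.Surjective ρ)
    (hker : ρ.ker = center K) : epicenter G = ⊥ := by
  rw [eq_bot_iff, ← (Subgroup.map_eq_bot_iff (center K)).2 hker.ge]
  exact epicenter_le_map_center hρ hker.le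

theorem isCapable_iff_epicenter_eq_bot : IsCapable G ↔ epicenter G = ⊥ := by
  constructor
  · rintro ⟨K, _, ⟨e⟩⟩
    refine epicenter_eq_bot_of_ker_eq_center (ρ := e.toMonoidHom.comp (QuotientGroup.mk' _))
      (e.surjective.comp (QuotientGroup.mk'_surjective _)) ?_
    exact (MonoidHom.ker_mulEquiv_comp _ e).trans (QuotientGroup.ker_mk' _)
  · intro h
    have hker : center (FreeCentralExtension G) = (FreeCentralExtension.proj G).ker :=
      ((Subgroup.map_eq_bot_iff _).1 h).antisymm FreeCentralExtension.ker_proj_le_center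
    exact ⟨FreeCentralExtension G, inferInstance, ⟨(QuotientGroup.quotientMulEquivOfEq hker).trans
      (QuotientGroup.quotientKerEquivOfSurjective _ FreeCentralExtension.proj_surjective)⟩⟩

theorem IsCapable.epicenter_le_ker (hQ : IsCapable Q) {f : G →* Q} (hf : Function.Surjective f) :
    epicenter G ≤ f.ker := by
  rw [← Subgroup.map_eq_bot_iff, eq_bot_iff, ← isCapable_iff_epicenter_eq_bot.1 hQ]
  exact map_epicenter_le hf

theorem IsCapable.of_mulEquiv (hG : IsCapable G) (e : G ≃* Q) : IsCapable Q := by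
  rw [isCapable_iff_epicenter_eq_bot, eq_bot_iff,
    ← (MonoidHom.ker_eq_bot_iff e.symm.toMonoidHom).2 e.symm.injective]
  exact hG.epicenter_le_ker e.symm.surjective

theorem IsCapable.prod (hG : IsCapable G) (hQ : IsCapable Q) : IsCapable (G × Q) :=
  isCapable_iff_epicenter_eq_bot.2 <| (eq_bot_iff_forall _).2 fun _ hx =>
    Prod.ext (hG.epicenter_le_ker (f := MonoidHom.fst G Q) Prod.fst_surjective hx)
      (hQ.epicenter_le_ker (f := MonoidHom.snd G Q) Prod.snd_surjective hx)

end Epicenter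

section DirectFactor

variable {G : Type u} {H : Type v} {K : Type w} [Group G] [Group H] [Group K]

theorem commutator_inf_centralizer_le_center {L M : Subgroup K} (hsup : L ⊔ M = ⊤)
    (hcomm : ⁅L, M⁆ ≤ center K) : ⁅L, L⁆ ⊓ centralizer (L : Set K) ≤ center K := by
  have hLM : ⁅⁅L, M⁆, L⁆ = ⊥ := le_bot_iff.1 <|
    (commutator_mono hcomm le_top).trans_eq (commutator_center_left ⊤)
  have hLL : ⁅L, L⁆ ≤ centralizer (M : Set K) := commutator_eq_bot_iff_le_centralizer.1 <|
    commutator_commutator_eq_bot_of_rotate hLM (by rwa [commutator_comm M L])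
  rw [← centralizer_univ, ← coe_top, ← hsup, le_centralizer_iff]
  exact sup_le (le_centralizer_iff.1 inf_le_right) (le_centralizer_iff.1 (inf_le_left.trans hLL))

theorem map_inl_epicenter_le_map_centralizer {π : K →* G × H} (hπ : Function.Surjective π)
    (hcentral : π.ker ≤ center K) :
    (epicenter G).map (MonoidHom.inl G H) ≤
      (centralizer (((MonoidHom.snd G H).comp π).ker : Set K)).map π := by
  let L : Subgroup K := ((MonoidHom.snd G H).comp π).ker
  let ρ : L →* G := ((MonoidHom.fst G H).comp π).comp L.subtype
  have hπρ (l : L) : π l = (ρ l, 1) := Prod.ext rfl l.2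
  have hρ : Function.Surjective ρ := fun g => by
    obtain ⟨l, hl⟩ := hπ (g, 1)
    exact ⟨⟨l, congrArg Prod.snd hl⟩, congrArg Prod.fst hl⟩
  have hρcentral : ρ.ker ≤ center L := fun z hz => mem_center_iff.2 fun l =>
    Subtype.ext (mem_center_iff.1 (hcentral ((hπρ z).trans (Prod.ext hz rfl))) l)
  rintro _ ⟨x, hx, rfl⟩
  obtain ⟨c, hc, rfl⟩ := epicenter_le_map_center hρ hρcentral hx
  exact ⟨c, fun l hl => congrArg Subtype.val (mem_center_iff.1 hc ⟨l, hl⟩), hπρ c⟩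

theorem map_inl_commutator_le_map_commutator {π : K →* G × H} (hπ : Function.Surjective π) :
    (commutator G).map (MonoidHom.inl G H) ≤
      ⁅((MonoidHom.snd G H).comp π).ker, ((MonoidHom.snd G H).comp π).ker⁆.map π := by
  have hinl : (⊤ : Subgroup G).map (MonoidHom.inl G H) ≤
      ((MonoidHom.snd G H).comp π).ker.map π := by
    rintro _ ⟨g, -, rfl⟩
    obtain ⟨l, hl⟩ := hπ (g, 1)
    exact ⟨l, congrArg Prod.snd hl, hl⟩
  rw [_root_.commutator_def, map_commutator, map_commutator]
  exact commutator_mono hinl hinl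

theorem ker_snd_comp_sup_ker_fst_comp_eq_top {π : K →* G × H} (hπ : Function.Surjective π) :
    ((MonoidHom.snd G H).comp π).ker ⊔ ((MonoidHom.fst G H).comp π).ker = ⊤ := by
  refine eq_top_iff.2 fun k _ => ?_
  obtain ⟨l, hl⟩ := hπ ((π k).1, 1)
  rw [← mul_inv_cancel_left l k]
  refine mul_mem_sup (congrArg Prod.snd hl) ?_
  simp [MonoidHom.mem_ker, hl]

theorem map_inl_epicenter_inf_commutator_le_epicenter :
    (epicenter G ⊓ commutator G).map (MonoidHom.inl G H) ≤ epicenter (G × H) := by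
  let π := FreeCentralExtension.proj (G × H)
  have hπ : Function.Surjective π := FreeCentralExtension.proj_surjective
  have hcentral : π.ker ≤ center _ := FreeCentralExtension.ker_proj_le_center
  let L := ((MonoidHom.snd G H).comp π).ker
  let M := ((MonoidHom.fst G H).comp π).ker
  have hLM : ⁅L, M⁆ ≤ center _ := (commutator_le_inf L M).trans fun z hz =>
    hcentral (Prod.ext hz.2 hz.1)
  rintro _ ⟨x, ⟨hxe, hxc⟩, rfl⟩
  obtain ⟨c, hc, hcx⟩ := map_inl_commutator_le_map_commutator hπ (mem_map_of_mem _ hxc)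
  have hcL : c ∈ centralizer (L : Set (FreeCentralExtension (G × H))) := by
    rw [← comap_map_eq_self (hcentral.trans (center_le_centralizer _)), mem_comap, hcx]
    exact map_inl_epicenter_le_map_centralizer hπ hcentral (mem_map_of_mem _ hxe)
  exact ⟨c, commutator_inf_centralizer_le_center (ker_snd_comp_sup_ker_fst_comp_eq_top hπ) hLM
    ⟨hc, hcL⟩, hcx⟩

theorem IsCapable.of_prod_left (hab : IsCapable (Abelianization G)) (h : IsCapable (G × H)) :
    IsCapable G := by
  refine isCapable_iff_epicenter_eq_bot.2 ((eq_bot_iff_forall _).2 fun x hx => ?_)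
  have hxc : x ∈ commutator G :=
    Abelianization.ker_of G ▸ hab.epicenter_le_ker QuotientGroup.mk_surjective hx
  have hx1 : MonoidHom.inl G H x ∈ epicenter (G × H) :=
    map_inl_epicenter_inf_commutator_le_epicenter (mem_map_of_mem _ ⟨hx, hxc⟩)
  rw [isCapable_iff_epicenter_eq_bot.1 h] at hx1
  exact congrArg Prod.fst hx1

end DirectFactor

section BilinearExtension

variable {R : Type*} {V : Type u} {W : Type w} [CommSemiring R] [AddCommGroup V] [AddCommGroup W]
  [Module R V] [Module R W]

/-- The central extension of the additive group `V` by `W` with the bilinear cocycle `B`; for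
`V = R × R` and `B (a, b) (c, d) = a * d` it is the Heisenberg group over `R`. -/
@[ext]
structure BilinearExtension (B : V →ₗ[R] V →ₗ[R] W) where
  base : V
  fibre : W

namespace BilinearExtension

variable {B : V →ₗ[R] V →ₗ[R] W}

instance : Mul (BilinearExtension B) :=
  ⟨fun a b => ⟨a.base + b.base, a.fibre + b.fibre + B a.base b.base⟩⟩

instance : One (BilinearExtension B) := ⟨⟨0, 0⟩⟩

instance : Inv (BilinearExtension B) := ⟨fun a => ⟨-a.base, -a.fibre + B a.base a.base⟩⟩

@[simp] theorem base_mul (a b : BilinearExtension B) : (a * b).base = a.base + b.base := rfl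

@[simp] theorem fibre_mul (a b : BilinearExtension B) :
    (a * b).fibre = a.fibre + b.fibre + B a.base b.base := rfl

@[simp] theorem base_one : (1 : BilinearExtension B).base = 0 := rfl

@[simp] theorem fibre_one : (1 : BilinearExtension B).fibre = 0 := rfl

@[simp] theorem base_inv (a : BilinearExtension B) : a⁻¹.base = -a.base := rfl

@[simp] theorem fibre_inv (a : BilinearExtension B) :
    a⁻¹.fibre = -a.fibre + B a.base a.base := rfl

instance : Group (BilinearExtension B) where
  mul_assoc a b c := by
    ext
    · simp [add_assoc]
    · simp only [fibre_mul, base_mul, map_add, LinearMap.add_apply]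
      abel
  one_mul a := by ext <;> simp
  mul_one a := by ext <;> simp
  inv_mul_cancel a := by ext <;> simp

theorem mem_center_iff {z : BilinearExtension B} :
    z ∈ center (BilinearExtension B) ↔ ∀ v, B v z.base = B z.base v := by
  rw [Subgroup.mem_center_iff]
  refine ⟨fun h v => ?_, fun h a => ?_⟩
  · simpa using congrArg fibre (h ⟨v, 0⟩)
  · ext
    · simp [add_comm]
    · simp [h, add_comm]

variable (B) in
/-- The projection of the extension with cocycle `B` onto its base. -/
def proj : BilinearExtension B →* Multiplicative V where
  toFun a := Multiplicative.ofAdd a.base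
  map_one' := rfl
  map_mul' _ _ := rfl

theorem proj_surjective : Function.Surjective (proj B) := fun v => ⟨⟨v.toAdd, 0⟩, rfl⟩

theorem mem_ker_proj {z : BilinearExtension B} : z ∈ (proj B).ker ↔ z.base = 0 := Iff.rfl

end BilinearExtension

theorem isCapable_multiplicative_of_bilinear (B : V →ₗ[R] V →ₗ[R] W)
    (hB : ∀ v, (∀ w, B w v = B v w) → v = 0) : IsCapable (Multiplicative V) := by
  have hker : (BilinearExtension.proj B).ker = center (BilinearExtension B) := by
    ext z
    rw [BilinearExtension.mem_ker_proj, BilinearExtension.mem_center_iff]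
    exact ⟨fun hz v => by rw [hz, map_zero, LinearMap.map_zero₂], hB z.base⟩
  exact isCapable_iff_epicenter_eq_bot.2 <|
    epicenter_eq_bot_of_ker_eq_center BilinearExtension.proj_surjective hker

end BilinearExtension

section ElementaryAbelian

open scoped TensorProduct

theorem mem_span_singleton_of_tmul_comm {k V : Type*} [Field k] [AddCommGroup V] [Module k V]
    {v w : V} (hv : v ≠ 0) (h : w ⊗ₜ[k] v = v ⊗ₜ[k] w) : w ∈ Submodule.span k {v} := by
  obtain ⟨f, hf⟩ := Module.Projective.exists_dual_eq_one k hv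
  refine Submodule.mem_span_singleton.2 ⟨f w, ?_⟩
  simpa [hf] using congrArg (TensorProduct.lid k V ∘ f.rTensor V) h

theorem isCapable_multiplicative_of_rank_ne_one {k : Type*} {V : Type u} [Field k]
    [AddCommGroup V] [Module k V] (hV : Module.rank k V ≠ 1) : IsCapable (Multiplicative V) := by
  refine isCapable_multiplicative_of_bilinear (TensorProduct.mk k V V) fun v hcomm => ?_
  by_contra hv
  exact hV <| rank_eq_one_iff.2 ⟨v, hv, fun w =>
    Submodule.mem_span_singleton.1 (mem_span_singleton_of_tmul_comm hv (hcomm w))⟩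

theorem isCapable_of_exponent_dvd_prime {A : Type u} [CommGroup A] {p : ℕ} (hp : p.Prime)
    (hexp : Monoid.exponent A ∣ p) (hA : ¬ IsCyclic A) : IsCapable A := by
  have : Fact p.Prime := ⟨hp⟩
  let _ : Module (ZMod p) (Additive A) :=
    AddCommGroup.zmodModule fun a : Additive A =>
      Monoid.exponent_dvd_iff_forall_pow_eq_one.1 hexp a.toMul
  have hrank : Module.rank (ZMod p) (Additive A) ≠ 1 := fun h => by
    obtain ⟨a, -, ha⟩ := rank_eq_one_iff.1 h
    refine hA ⟨a.toMul, fun b => ?_⟩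
    obtain ⟨c, hc⟩ := ha (Additive.ofMul b)
    obtain ⟨n, rfl⟩ := ZMod.intCast_surjective c
    exact ⟨n, by rwa [Int.cast_smul_eq_zsmul] at hc⟩
  exact (isCapable_multiplicative_of_rank_ne_one hrank).of_mulEquiv
    (MulEquiv.multiplicativeAdditive A)

end ElementaryAbelian

section Nilpotent

theorem isCyclic_of_isCyclic_abelianization (G : Type u) [Group G] [Group.IsNilpotent G]
    (hab : IsCyclic (Abelianization G)) : IsCyclic G := by
  revert hab
  refine Group.nilpotent_center_quotient_ind
    (P := fun G _ _ => IsCyclic (Abelianization G) → IsCyclic G) G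
    (fun _ _ _ _ => inferInstance) fun G _ _ ih hab => ?_
  have hsurj : Function.Surjective (Abelianization.map (QuotientGroup.mk' (center G))) :=
    Function.Surjective.of_comp (g := Abelianization.of) <|
      QuotientGroup.mk_surjective.comp (QuotientGroup.mk'_surjective _)
  have : IsCyclic (G ⧸ center G) := ih (isCyclic_of_surjective _ hsurj)
  have : IsMulCommutative G := isMulCommutative_of_isCyclic_quotient_center_self G
  refine isCyclic_of_injective Abelianization.of ((MonoidHom.ker_eq_bot_iff _).1 ?_)
  rw [Abelianization.ker_of, commutator_eq_bot]

theorem isCapable_abelianization {G : Type u} [Group G] [Group.IsNilpotent G] {p : ℕ}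
    (hp : p.Prime) (hexp : Monoid.exponent G ∣ p) (hG : ¬ IsCyclic G) :
    IsCapable (Abelianization G) := by
  refine isCapable_of_exponent_dvd_prime hp ?_ fun hab =>
    hG (isCyclic_of_isCyclic_abelianization G hab)
  exact (MonoidHom.exponent_dvd (f := Abelianization.of) QuotientGroup.mk_surjective).trans hexp

end Nilpotent

theorem mainTheorem12_general {G₁ : Type u} {G₂ : Type v} [Group G₁] [Group G₂]
    (hab₁ : IsCapable (Abelianization G₁)) (hab₂ : IsCapable (Abelianization G₂)) :
    IsCapable (G₁ × G₂) ↔ IsCapable G₁ ∧ IsCapable G₂ :=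
  ⟨fun h => ⟨.of_prod_left hab₁ h, .of_prod_left hab₂ (h.of_mulEquiv MulEquiv.prodComm)⟩,
    fun h => h.1.prod h.2⟩

theorem mainTheorem12 (p : ℕ) (hp : p.Prime) (hp2 : p ≠ 2)
    (G₁ : Type u) (G₂ : Type v) [Group G₁] [Group G₂] [Finite G₁] [Finite G₂]
    [Group.IsNilpotent G₁] [Group.IsNilpotent G₂]
    (hcl₁ : Group.nilpotencyClass G₁ ≤ 2) (hcl₂ : Group.nilpotencyClass G₂ ≤ 2)
    (hexp₁ : Monoid.exponent G₁ = p) (hexp₂ : Monoid.exponent G₂ = p)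
    (hnc₁ : ¬ IsCyclic G₁) (hnc₂ : ¬ IsCyclic G₂) :
    IsCapable (G₁ × G₂) ↔ IsCapable G₁ ∧ IsCapable G₂ :=
  mainTheorem12_general (isCapable_abelianization hp hexp₁.dvd hnc₁)
    (isCapable_abelianization hp hexp₂.dvd hnc₂)
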